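/- Let $n$ and $k$ be integers with $k \ge 3$ and $3k-3 \le n \le k^2-k+1$, and let $\binom{[n]}{k}$ denote the family of all $k$-element subsets of $[n]=\{1,\dots,n\}$. Let $G(n,k,1)$ be the graph with vertex set $\binom{[n]}{k}$ in which two distinct sets $A,B$ are adjacent if and only if $|A\cap B|=1$. For a finite graph $G=(V,E)$ let $\alpha(G)$ be its independence number, and let $$\vartheta'(G)=\min\{\operatorname{lev}(A) : A \text{ is a real symmetric } V\times V \text{ matrix with } a_{ij}\ge 1 \text{ for all } i,j\in V \text{ (including } i=j\text{) with } \{i,j\}\notin E\}$$ be its Delsarte number (Schrijver's variant of the Lovász number), where $\operatorname{lev}(A)$ is the largest eigenvalue of $A$. Then: 1. every family $\mathcal F\subset\binom{[n]}{k}$ in which no two distinct members meet in exactly one element, that is, every $(n,k,\{0,2,3,\dots,k-1\})$-system, satisfies $|\mathcal F|\le\binom{n-2}{k-2}$; 2. $\alpha(G(n,k,1))=\binom{n-2}{k-2}$; 3. the minimum defining $\vartheta'(G(n,k,1))$ is attained, and $\vartheta'(G(n,k,1))=\binom{n-2}{k-2}$. -/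

import Mathlib

namespace ForbiddenIntersection

/-- An `(n, k, L)`-system: a family of `k`-element subsets of an `n`-element ground set
(here `Fin n`) such that any two distinct members meet in a number of elements belonging to `L`. -/
def IsSystem (n k : ℕ) (L : Set ℕ) (F : Finset (Finset (Fin n))) : Prop :=
  (∀ A ∈ F, A.card = k) ∧ ∀ A ∈ F, ∀ B ∈ F, A ≠ B → (A ∩ B).card ∈ L

/-- The set `{0, 1, …, k - 1} \ {ℓ}` of intersection sizes that are allowed when only the
size `ℓ` is forbidden. -/
def allBut (k ℓ : ℕ) : Set ℕ := {i | i < k ∧ i ≠ ℓ}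

/-- The generalized Johnson graph `G(n, k, L)`: its vertices are the `k`-element subsets of
an `n`-element set, and distinct `A`, `B` are adjacent if and only if `|A ∩ B| ∉ L`. -/
def generalizedJohnson (n k : ℕ) (L : Set ℕ) :
    SimpleGraph {A : Finset (Fin n) // A.card = k} where
  Adj A B := A ≠ B ∧ (A.1 ∩ B.1).card ∉ L
  symm := ⟨fun A B h => ⟨h.1.symm, by rw [Finset.inter_comm]; exact h.2⟩⟩
  loopless := ⟨fun _ h => h.1 rfl⟩

/-- `r` is the largest eigenvalue `lev A` of the real square matrix `A`. -/
def IsLargestEigenvalue {V : Type*} [Fintype V] [DecidableEq V]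
    (A : Matrix V V ℝ) (r : ℝ) : Prop :=
  IsGreatest {μ : ℝ | Module.End.HasEigenvalue (Matrix.toLin' A) μ} r

/-- The set of the numbers `lev A`, where `A` runs over the real symmetric `V × V` matrices with
`A i j ≥ 1` whenever `{i, j}` is not an edge of `G` (in particular whenever `i = j`). -/
def delsarteValues {V : Type*} [Fintype V] [DecidableEq V] (G : SimpleGraph V) : Set ℝ :=
  {r | ∃ A : Matrix V V ℝ,
    A.IsSymm ∧ (∀ i j, ¬ G.Adj i j → 1 ≤ A i j) ∧ IsLargestEigenvalue A r}

/-- The Delsarte number `ϑ'(G)` (Schrijver's variant of the Lovász number). That the infimum is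
a minimum for the graphs at hand is asserted separately, where it is needed. -/
noncomputable def delsarteNumber {V : Type*} [Fintype V] [DecidableEq V]
    (G : SimpleGraph V) : ℝ :=
  sInf (delsarteValues G)

end ForbiddenIntersection

/-!
The stars `{A | {p, q} ⊆ A}` are independent sets of size `M = (n - 2).choose (k - 2)`. An
independent set `s` satisfies `|s| ≤ r` whenever `r` is the largest eigenvalue of an admissible
matrix, by comparing both sides of the Rayleigh inequality at the indicator vector of `s`
(`card_le_of_mem_delsarteValues`). So `M` is a lower bound for the Delsarte number and everything
follows from one admissible matrix with largest eigenvalue `M`.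

Complementary slackness with a star leaves only the matrices `J + x D₀ - y D₁`, where `J` is the
all-ones matrix and `Dᵢ` the indicator matrix of `|A ∩ B| = i`, and it forces the eigenvalues on
the first three eigenspaces of the Johnson scheme to be `M`. This determines `x` and `y`
(`extremalMatrix`), and admissibility, that is `x ≥ 0`, is the condition `n ≤ k² - k + 1`.

The decomposition into eigenspaces is not needed to find the possible eigenvalues. For an
eigenvector `f`, take a set `S` of least size `j` such that the sum of `f` over the `k`-sets
containing `S` is nonzero. Summing the eigenvalue equation over these `k`-sets gives, by
inclusion–exclusion, a multiple of the same sum, and the factor is the eigenvalue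
(`supersetSum_mulVec`, `exists_eq_of_mulVec_eq_smul`). For the chosen `x` and `y` it is a positive
constant times `(-1) ^ j * (n - k - j).choose (k - j) * ((j - 1) * (n - j) - (k - 1))` for `j ≥ 1`
(`eigenvalue_eq`), and `M` is the value for `j = 2`. For `j = 1` the value is `M` again and for
odd `j ≥ 3` it is negative or zero. From `j = 3` on its absolute value does not increase
(`eigenvalueProfile_succ_le`), so the decisive comparison is the one of `j = 4` with `j = 2`, which
is the condition `n ≥ 3 k - 3` (`eigenvalueProfile_four_le`).
-/

namespace ForbiddenIntersection

open Finset

/-! ### Counting `k`-sets with a prescribed intersection -/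

theorem card_filter_inter_eq {n k : ℕ} {P Q : Finset (Fin n)} (hPQ : P ⊆ Q) :
    #{A : {A : Finset (Fin n) // A.card = k} | A.1 ∩ Q = P} =
      if P.card ≤ k then (n - Q.card).choose (k - P.card) else 0 := by
  split_ifs with h
  · have hQ : #(Qᶜ) = n - Q.card := by rw [card_compl, Fintype.card_fin]
    rw [← hQ, ← card_powersetCard]
    refine card_bij (fun A _ => A.1 \ Q) ?_ ?_ ?_
    · intro A hA
      rw [mem_filter] at hA
      rw [mem_powersetCard]
      refine ⟨fun a ha => mem_compl.2 (mem_sdiff.1 ha).2, ?_⟩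
      have := card_sdiff_add_card_inter A.1 Q
      rw [hA.2, A.2] at this
      omega
    · intro A hA B hB h
      rw [mem_filter] at hA hB
      apply Subtype.ext
      rw [← sdiff_union_inter A.1 Q, ← sdiff_union_inter B.1 Q, hA.2, hB.2, h]
    · intro T hT
      rw [mem_powersetCard] at hT
      have hTQ : Disjoint T Q := disjoint_left.2 fun a ha => mem_compl.1 (hT.1 ha)
      refine ⟨⟨T ∪ P, ?_⟩, ?_, ?_⟩
      · rw [card_union_of_disjoint (disjoint_of_subset_right hPQ hTQ), hT.2]
        omega
      · rw [mem_filter]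
        refine ⟨mem_univ _, ?_⟩
        change (T ∪ P) ∩ Q = P
        rw [union_inter_distrib_right, disjoint_iff_inter_eq_empty.1 hTQ, empty_union,
          inter_eq_left.2 hPQ]
      · change (T ∪ P) \ Q = T
        rw [union_sdiff_distrib, sdiff_eq_empty_iff_subset.2 hPQ, union_empty,
          sdiff_eq_self_of_disjoint hTQ]
  · rw [card_eq_zero, filter_eq_empty_iff]
    intro A _ hA
    exact h (hA ▸ (card_le_card inter_subset_left).trans A.2.le)

theorem card_filter_superset_disjoint {n k : ℕ} {S B : Finset (Fin n)} (hB : B.card = k)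
    (hS : S.card ≤ k) :
    #{A : {A : Finset (Fin n) // A.card = k} | S ⊆ A.1 ∧ (A.1 ∩ B).card = 0} =
      if (B ∩ S).card = 0 then (n - k - S.card).choose (k - S.card) else 0 := by
  split_ifs with h
  · have hd : Disjoint B S := disjoint_iff_inter_eq_empty.2 (card_eq_zero.1 h)
    have := card_filter_inter_eq (k := k) (subset_union_right (s₁ := B) (s₂ := S))
    rw [if_pos hS, card_union_of_disjoint hd, hB, ← Nat.sub_sub] at this
    rw [← this]
    congr 1
    ext A
    simp only [mem_filter, mem_univ, true_and, card_eq_zero]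
    constructor
    · rintro ⟨h1, h2⟩
      rw [inter_union_distrib_left, h2, empty_union, inter_eq_right.2 h1]
    · intro hA
      refine ⟨?_, ?_⟩
      · rw [← hA]; exact inter_subset_left
      · rw [← subset_empty, ← disjoint_iff_inter_eq_empty.1 hd]
        intro a ha
        rw [mem_inter] at ha ⊢
        refine ⟨ha.2, ?_⟩
        rw [← hA]
        exact mem_inter.2 ⟨ha.1, mem_union_left _ ha.2⟩
  · rw [card_eq_zero, filter_eq_empty_iff]
    rintro A _ ⟨h1, h2⟩
    apply h
    rw [card_eq_zero, ← subset_empty, ← card_eq_zero.1 h2, inter_comm]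
    exact inter_subset_inter_right h1

/-- The number of `k`-sets `A ⊇ S` that meet the `k`-set `B` in one element: this element lies
in `S` or not according to whether `S` meets `B` in one element or not at all. The case
distinction in the first value avoids the truncated subtraction `k - (k + 1) = 0`. -/
theorem card_filter_superset_inter_one {n k : ℕ} {S B : Finset (Fin n)} (hB : B.card = k)
    (hS : S.card ≤ k) :
    #{A : {A : Finset (Fin n) // A.card = k} | S ⊆ A.1 ∧ (A.1 ∩ B).card = 1} =
      (if (B ∩ S).card = 0 then
        k * (if S.card + 1 ≤ k then (n - k - S.card).choose (k - (S.card + 1)) else 0) else 0) +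
      if (B ∩ S).card = 1 then (n + 1 - (k + S.card)).choose (k - S.card) else 0 := by
  rcases Nat.lt_or_ge 1 (B ∩ S).card with h2 | h2
  · rw [if_neg (by omega), if_neg (by omega), card_eq_zero, filter_eq_empty_iff]
    rintro A _ ⟨h3, h4⟩
    have : B ∩ S ⊆ A.1 ∩ B := by
      rw [inter_comm]; exact inter_subset_inter_right h3
    have := card_le_card this
    omega
  have hu := card_union_add_card_inter B S
  obtain h | h : (B ∩ S).card = 0 ∨ (B ∩ S).card = 1 := by omega
  · rw [if_pos h, if_neg (c := (B ∩ S).card = 1) (by omega), add_zero]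
    have hd : Disjoint B S := disjoint_iff_inter_eq_empty.2 (card_eq_zero.1 h)
    have hone : ∀ b ∈ B, #{A : {A : Finset (Fin n) // A.card = k} | A.1 ∩ (B ∪ S) = insert b S} =
        if S.card + 1 ≤ k then (n - k - S.card).choose (k - (S.card + 1)) else 0 := by
      intro b hb
      have := card_filter_inter_eq (k := k) (P := insert b S) (Q := B ∪ S)
        (insert_subset (mem_union_left _ hb) subset_union_right)
      rwa [card_insert_of_notMem (disjoint_left.1 hd hb), card_union_of_disjoint hd, hB,
        ← Nat.sub_sub] at this
    have hsum := sum_congr rfl hone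
    rw [sum_const, hB, smul_eq_mul] at hsum
    rw [← hsum, ← card_biUnion]
    · congr 1
      ext A
      simp only [mem_filter, mem_univ, true_and, mem_biUnion]
      constructor
      · rintro ⟨h1, h2⟩
        obtain ⟨b, hb⟩ := card_eq_one.1 h2
        refine ⟨b, ?_, ?_⟩
        · have : b ∈ A.1 ∩ B := by rw [hb]; exact mem_singleton_self b
          exact (mem_inter.1 this).2
        · rw [inter_union_distrib_left, hb, inter_eq_right.2 h1]; rfl
      · rintro ⟨b, hb, hA⟩
        refine ⟨?_, card_eq_one.2 ⟨b, ?_⟩⟩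
        · exact (subset_insert b S).trans (hA ▸ inter_subset_left)
        · ext a
          have := congrArg (a ∈ ·) hA
          simp only [mem_inter, mem_union, mem_insert, eq_iff_iff] at this
          have hab : a ∈ B → a ∉ S := fun h => disjoint_left.1 hd h
          rw [mem_inter, mem_singleton]
          constructor
          · rintro ⟨h1, h2⟩
            exact (this.1 ⟨h1, Or.inl h2⟩).resolve_right (hab h2)
          · rintro rfl
            exact ⟨(this.2 (Or.inl rfl)).1, hb⟩
    · intro b hb b' hb' hne
      rw [Function.onFun, disjoint_left]
      intro A hA hA'
      rw [mem_filter] at hA hA'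
      have : b ∈ insert b' S := by
        rw [← hA'.2, hA.2]; exact mem_insert_self b S
      exact (mem_insert.1 this).elim hne (disjoint_left.1 hd hb)
  · rw [if_neg (by omega), if_pos h, zero_add]
    have := card_filter_inter_eq (k := k) (subset_union_right (s₁ := B) (s₂ := S))
    have hc : n - (B ∪ S).card = n + 1 - (k + S.card) := by omega
    rw [if_pos hS, hc] at this
    rw [← this]
    congr 1
    ext A
    simp only [mem_filter, mem_univ, true_and]
    constructor
    · rintro ⟨h1, h2⟩
      have h3 : B ∩ S ⊆ A.1 ∩ B := by
        rw [inter_comm]; exact inter_subset_inter_right h1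
      have h4 := eq_of_subset_of_card_le h3 (by omega)
      rw [inter_union_distrib_left, ← h4, inter_eq_right.2 h1, union_eq_right]
      exact inter_subset_right
    · intro hA
      have h1 : S ⊆ A.1 := hA ▸ inter_subset_left
      refine ⟨h1, ?_⟩
      rw [← h]
      congr 1
      ext a
      have := congrArg (a ∈ ·) hA
      simp only [mem_inter, mem_union, eq_iff_iff] at this ⊢
      have := @h1 a
      tauto

/-! ### Sums over the supersets of a set -/

/-- The sum of `f` over the `k`-sets that contain `S`. -/
def supersetSum {n k : ℕ} (f : {A : Finset (Fin n) // A.card = k} → ℝ)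
    (S : Finset (Fin n)) : ℝ :=
  ∑ B, if S ⊆ B.1 then f B else 0

/-- Inclusion–exclusion over the subsets of `S`, of which only `S` itself contributes. -/
theorem sum_disjoint_eq {n k : ℕ} {f : {A : Finset (Fin n) // A.card = k} → ℝ}
    {S : Finset (Fin n)} (hf : ∀ T, T.card < S.card → supersetSum f T = 0) :
    (∑ B, if (B.1 ∩ S).card = 0 then f B else 0) = (-1) ^ S.card * supersetSum f S := by
  have key : ∀ B : {A : Finset (Fin n) // A.card = k},
      (if (B.1 ∩ S).card = 0 then f B else 0) =
        ∑ T ∈ S.powerset, (-1) ^ T.card * (if T ⊆ B.1 then f B else 0) := by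
    intro B
    have h1 := sum_powerset_neg_one_pow_card (x := B.1 ∩ S)
    have h2 : (B.1 ∩ S).powerset = S.powerset.filter (· ⊆ B.1) := by
      ext T; simp only [mem_powerset, mem_filter, subset_inter_iff]; tauto
    rw [h2, sum_filter] at h1
    have h3 := congrArg (fun z : ℤ => (z : ℝ) * f B) h1
    simp only [Int.cast_sum, sum_mul] at h3
    simp only [card_eq_zero]
    convert h3.symm using 1
    · split_ifs <;> simp
    · refine sum_congr rfl fun T _ => ?_
      split_ifs <;> simp
  rw [sum_congr rfl fun B _ => key B, sum_comm]
  simp only [← mul_sum]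
  rw [sum_eq_single S]
  · rfl
  · intro T hT hne
    have : supersetSum f T = 0 :=
      hf T (card_lt_card ((mem_powerset.1 hT).ssubset_of_ne hne))
    rw [supersetSum] at this
    rw [this, mul_zero]
  · intro h; exact absurd (mem_powerset_self S) h

/-- The analogue of `sum_disjoint_eq` for the sets that meet `S` in one element. -/
theorem sum_inter_one_eq {n k : ℕ} {f : {A : Finset (Fin n) // A.card = k} → ℝ}
    {S : Finset (Fin n)} (hf : ∀ T, T.card < S.card → supersetSum f T = 0) :
    (∑ B, if (B.1 ∩ S).card = 1 then f B else 0) =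
      -((-1) ^ S.card * S.card * supersetSum f S) := by
  -- a set `B` meets `S` in `{s}` iff it misses `S \ {s}` but not `S`
  have key : ∀ B : {A : Finset (Fin n) // A.card = k},
      (if (B.1 ∩ S).card = 1 then f B else 0) =
        ∑ s ∈ S, ((if (B.1 ∩ S.erase s).card = 0 then f B else 0) -
          (if (B.1 ∩ S).card = 0 then f B else 0)) := by
    intro B
    simp only [inter_erase]
    have hX : B.1 ∩ S ⊆ S := inter_subset_right
    generalize B.1 ∩ S = X at hX
    by_cases h0 : X = ∅
    · simp [h0]
    · have hX0 : X.card ≠ 0 := by rwa [Ne, card_eq_zero]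
      simp only [if_neg hX0, sub_zero]
      by_cases h1 : X.card = 1
      · obtain ⟨a, rfl⟩ := card_eq_one.1 h1
        rw [if_pos h1, sum_eq_single a]
        · simp
        · intro b _ hb
          rw [if_neg]
          rw [erase_eq_of_notMem (by simpa using hb)]
          exact hX0
        · intro h; exact absurd (hX (mem_singleton_self a)) h
      · rw [if_neg h1, sum_eq_zero]
        intro s _
        rw [if_neg]
        have := pred_card_le_card_erase (s := X) (a := s)
        omega
  rw [sum_congr rfl fun B _ => key B, sum_comm]
  have hs : ∀ s ∈ S, (∑ B : {A : Finset (Fin n) // A.card = k},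
      ((if (B.1 ∩ S.erase s).card = 0 then f B else 0) -
          (if (B.1 ∩ S).card = 0 then f B else 0))) = -((-1) ^ S.card * supersetSum f S) := by
    intro s hs
    have hlt : (S.erase s).card < S.card := card_erase_lt_of_mem hs
    rw [sum_sub_distrib, sum_disjoint_eq hf,
      sum_disjoint_eq (fun T hT => hf T (hT.trans hlt)), hf _ hlt]
    ring
  rw [sum_congr rfl hs, sum_const, nsmul_eq_mul]
  ring

/-! ### Eigenvalues of combinations of intersection matrices -/

/-- The matrix `J + x D₀ - y D₁` on the `k`-subsets of `Fin n`, where `J` is the all-ones matrix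
and `Dᵢ` is the indicator matrix of `|A ∩ B| = i`. -/
def intersectionMatrix (n k : ℕ) (x y : ℝ) :
    Matrix {A : Finset (Fin n) // A.card = k} {A : Finset (Fin n) // A.card = k} ℝ :=
  Matrix.of fun A B =>
    1 + (if (A.1 ∩ B.1).card = 0 then x else 0) - (if (A.1 ∩ B.1).card = 1 then y else 0)

theorem intersectionMatrix_isSymm (n k : ℕ) (x y : ℝ) : (intersectionMatrix n k x y).IsSymm := by
  ext A B
  simp only [intersectionMatrix, Matrix.transpose_apply, Matrix.of_apply, inter_comm]

theorem card_filter_superset {n k : ℕ} {S : Finset (Fin n)} (hS : S.card ≤ k) :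
    #{A : {A : Finset (Fin n) // A.card = k} | S ⊆ A.1} =
      (n - S.card).choose (k - S.card) := by
  have := card_filter_inter_eq (k := k) (Subset.refl S)
  rw [if_pos hS] at this
  rw [← this]
  simp only [inter_eq_right]

theorem sum_superset_intersectionMatrix {n k : ℕ} (x y : ℝ) {S : Finset (Fin n)}
    (hS : S.card ≤ k) (B : {A : Finset (Fin n) // A.card = k}) :
    (∑ A : {A : Finset (Fin n) // A.card = k},
      if S ⊆ A.1 then intersectionMatrix n k x y A B else 0) =
      (n - S.card).choose (k - S.card) +
      (if (B.1 ∩ S).card = 0 then x * (n - k - S.card).choose (k - S.card) -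
        y * (k * (if S.card + 1 ≤ k then ((n - k - S.card).choose (k - (S.card + 1)) : ℝ) else 0))
        else 0) -
      (if (B.1 ∩ S).card = 1 then y * (n + 1 - (k + S.card)).choose (k - S.card) else 0) := by
  have h0 := congrArg (Nat.cast : ℕ → ℝ) (card_filter_superset_disjoint B.2 hS)
  have h1 := congrArg (Nat.cast : ℕ → ℝ) (card_filter_superset_inter_one B.2 hS)
  have h2 := congrArg (Nat.cast : ℕ → ℝ) (card_filter_superset (k := k) hS)
  have e : ∀ A : {A : Finset (Fin n) // A.card = k},
      (if S ⊆ A.1 then intersectionMatrix n k x y A B else 0) =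
        (if S ⊆ A.1 then 1 else 0) +
          x * (if S ⊆ A.1 ∧ (A.1 ∩ B.1).card = 0 then 1 else 0) -
          y * (if S ⊆ A.1 ∧ (A.1 ∩ B.1).card = 1 then 1 else 0) := by
    intro A
    by_cases h : S ⊆ A.1 <;> simp [h, intersectionMatrix]
  rw [sum_congr rfl fun A _ => e A, sum_sub_distrib, sum_add_distrib, ← mul_sum, ← mul_sum,
    sum_boole, sum_boole, sum_boole, h0, h1, h2]
  push_cast
  split_ifs <;> ring

theorem supersetSum_mulVec {n k : ℕ} (x y : ℝ) {S : Finset (Fin n)} (hS : S.card ≤ k)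
    {f : {A : Finset (Fin n) // A.card = k} → ℝ}
    (hf : ∀ T, T.card < S.card → supersetSum f T = 0) :
    supersetSum ((intersectionMatrix n k x y).mulVec f) S =
      ((if S.card = 0 then (n.choose k : ℝ) else 0) + (-1) ^ S.card *
        (x * (n - k - S.card).choose (k - S.card) -
        y * (k * (if S.card + 1 ≤ k then ((n - k - S.card).choose (k - (S.card + 1)) : ℝ) else 0) -
          S.card * (n + 1 - (k + S.card)).choose (k - S.card)))) * supersetSum f S := by
  have e : supersetSum ((intersectionMatrix n k x y).mulVec f) S =
      ∑ B, (∑ A : {A : Finset (Fin n) // A.card = k},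
        if S ⊆ A.1 then intersectionMatrix n k x y A B else 0) * f B := by
    simp only [supersetSum, Matrix.mulVec, dotProduct, sum_mul]
    rw [sum_comm]
    refine sum_congr rfl fun A _ => ?_
    split_ifs <;> simp
  have hJ : ((n - S.card).choose (k - S.card) : ℝ) * ∑ B, f B =
      (if S.card = 0 then (n.choose k : ℝ) else 0) * supersetSum f S := by
    have h : ∑ B, f B = supersetSum f ∅ := by simp [supersetSum]
    split_ifs with h0
    · rw [h, card_eq_zero.1 h0]; simp
    · rw [h, hf ∅ (by rw [card_empty]; omega)]; simp
  have hlin : ∀ (t a b : ℝ) (B : {A : Finset (Fin n) // A.card = k}),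
      (t + (if (B.1 ∩ S).card = 0 then a else 0) - (if (B.1 ∩ S).card = 1 then b else 0)) * f B =
        t * f B + a * (if (B.1 ∩ S).card = 0 then f B else 0) -
          b * (if (B.1 ∩ S).card = 1 then f B else 0) := by
    intro t a b B
    split_ifs <;> ring
  rw [e, sum_congr rfl fun B _ => by rw [sum_superset_intersectionMatrix x y hS B, hlin],
    sum_sub_distrib, sum_add_distrib, ← mul_sum, ← mul_sum, ← mul_sum, hJ, sum_disjoint_eq hf,
    sum_inter_one_eq hf]
  ring

/-- The eigenvalues of `J + x D₀ - y D₁` are indexed by the least size `j` of a set `S` for which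
the eigenvector `f` has a nonzero sum over the supersets of `S`: summing the eigenvalue equation
over the supersets of `S` reduces it to a multiple of that sum. -/
theorem exists_eq_of_mulVec_eq_smul {n k : ℕ} {x y μ : ℝ}
    {f : {A : Finset (Fin n) // A.card = k} → ℝ} (hf : f ≠ 0)
    (hμ : (intersectionMatrix n k x y).mulVec f = μ • f) :
    ∃ j ≤ k, μ = (if j = 0 then (n.choose k : ℝ) else 0) + (-1) ^ j *
        (x * (n - k - j).choose (k - j) -
        y * (k * (if j + 1 ≤ k then ((n - k - j).choose (k - (j + 1)) : ℝ) else 0) -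
          j * (n + 1 - (k + j)).choose (k - j))) := by
  classical
  have hex : ∃ j, ∃ S : Finset (Fin n), S.card = j ∧ supersetSum f S ≠ 0 := by
    obtain ⟨A, hA⟩ := Function.ne_iff.1 hf
    refine ⟨_, A.1, rfl, ?_⟩
    rw [supersetSum, sum_eq_single A]
    · simpa using hA
    · intro B _ hB
      rw [if_neg]
      intro h
      exact hB (Subtype.ext (eq_of_subset_of_card_le h (by rw [A.2, B.2])).symm)
    · intro h; exact absurd (mem_univ A) h
  obtain ⟨S, hSj, hS⟩ := Nat.find_spec hex
  have hmin : ∀ T : Finset (Fin n), T.card < S.card → supersetSum f T = 0 := by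
    intro T hT
    by_contra h
    exact Nat.find_min hex (hSj ▸ hT) ⟨T, rfl, h⟩
  have hSk : S.card ≤ k := by
    obtain ⟨A, -, hA⟩ := exists_ne_zero_of_sum_ne_zero hS
    have : S ⊆ A.1 := by
      by_contra h
      exact hA (if_neg h)
    exact (card_le_card this).trans A.2.le
  refine ⟨S.card, hSk, ?_⟩
  have h := supersetSum_mulVec x y hSk hmin
  rw [hμ] at h
  refine mul_right_cancel₀ hS (Eq.trans ?_ h)
  simp only [supersetSum, Pi.smul_apply, smul_eq_mul, mul_sum, mul_ite_zero]

/-- The all-ones vector is an eigenvector. -/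
theorem intersectionMatrix_mulVec_one (n k : ℕ) (x y : ℝ) (hk : 1 ≤ k) :
    (intersectionMatrix n k x y).mulVec 1 =
      ((n.choose k : ℝ) + (x * (n - k).choose k - y * (k * (n - k).choose (k - 1)))) •
        (1 : {A : Finset (Fin n) // A.card = k} → ℝ) := by
  ext A
  have := sum_superset_intersectionMatrix x y (S := ∅) (by simp) A
  simp only [empty_subset, if_true, inter_empty, card_empty, zero_add, Nat.sub_zero, if_pos hk,
    zero_ne_one, if_false, sub_zero] at this
  simp only [Matrix.mulVec, dotProduct, Pi.one_apply, mul_one, Pi.smul_apply, smul_eq_mul]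
  rw [← this]
  refine sum_congr rfl fun B _ => ?_
  exact (intersectionMatrix_isSymm n k x y).apply B A

/-! ### The extremal matrix -/

/-- Up to sign, the eigenvalue of `D₀` belonging to `j`. -/
noncomputable def disjointEigenvalue (n k j : ℕ) : ℝ := (n - k - j).choose (k - j)

/-- Up to the factor `scale n k` and the sign `(-1) ^ j`, the eigenvalue of `x D₀ - y D₁`
belonging to `j`, for the weights `x`, `y` of `extremalMatrix`. -/
noncomputable def eigenvalueProfile (n k j : ℕ) : ℝ :=
  disjointEigenvalue n k j * ((j - 1) * (n - j) - (k - 1))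

/-- The factor that makes the eigenvalues belonging to `1` and `2` equal to
`(n - 2).choose (k - 2)`. -/
noncomputable def scale (n k : ℕ) : ℝ :=
  (n - 2).choose (k - 2) / eigenvalueProfile n k 2

/-- The matrix at which the minimum defining the Delsarte number is attained. -/
noncomputable def extremalMatrix (n k : ℕ) :
    Matrix {A : Finset (Fin n) // A.card = k} {A : Finset (Fin n) // A.card = k} ℝ :=
  intersectionMatrix n k (scale n k * (k ^ 2 - k + 1 - n)) (scale n k * (n - 2 * k + 1))

theorem disjointEigenvalue_nonneg (n k j : ℕ) : 0 ≤ disjointEigenvalue n k j :=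
  Nat.cast_nonneg _

theorem disjointEigenvalue_pos {n k : ℕ} (j : ℕ) (hn : 2 * k ≤ n) :
    0 < disjointEigenvalue n k j :=
  Nat.cast_pos.2 (Nat.choose_pos (by omega))

theorem disjointEigenvalue_succ {n k j : ℕ} (hj : j < k) (hn : 2 * k ≤ n) :
    disjointEigenvalue n k (j + 1) * (n - k - j) = disjointEigenvalue n k j * (k - j) := by
  obtain ⟨q, rfl⟩ := Nat.exists_eq_add_of_lt hj
  obtain ⟨p, rfl⟩ := Nat.exists_eq_add_of_le hn
  have h := Nat.add_one_mul_choose_eq (q + p) q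
  have e1 : 2 * (j + q + 1) + p - (j + q + 1) - (j + 1) = q + p := by omega
  have e2 : 2 * (j + q + 1) + p - (j + q + 1) - j = q + p + 1 := by omega
  have e3 : j + q + 1 - (j + 1) = q := by omega
  have e4 : j + q + 1 - j = q + 1 := by omega
  rw [disjointEigenvalue, disjointEigenvalue, e1, e2, e3, e4]
  have h' := congrArg (Nat.cast : ℕ → ℝ) h
  push_cast at h' ⊢
  linear_combination h'

theorem eigenvalueProfile_two_pos {n k : ℕ} (hn : 2 * k ≤ n) (hk : 2 ≤ k) :
    0 < eigenvalueProfile n k 2 := by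
  refine mul_pos (disjointEigenvalue_pos 2 hn) ?_
  have h1 : (2 : ℝ) * k ≤ n := by exact_mod_cast hn
  have h2 : (2 : ℝ) ≤ k := by exact_mod_cast hk
  push_cast
  linarith

theorem scale_pos {n k : ℕ} (hn : 2 * k ≤ n) (hk : 2 ≤ k) : 0 < scale n k :=
  div_pos (Nat.cast_pos.2 (Nat.choose_pos (by omega))) (eigenvalueProfile_two_pos hn hk)

theorem scale_mul_eigenvalueProfile_two {n k : ℕ} (hn : 2 * k ≤ n) (hk : 2 ≤ k) :
    scale n k * eigenvalueProfile n k 2 = (n - 2).choose (k - 2) :=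
  div_mul_cancel₀ _ (eigenvalueProfile_two_pos hn hk).ne'

/-- Pascal's rule and absorption express all binomial coefficients through
`(n - k - j).choose (k - j)`, and the factor `n - 2 * k + 1` in the second weight clears the
denominator. -/
theorem eigenvalue_eq {n k j : ℕ} (c : ℝ) (hj : j ≤ k) (hn : 2 * k ≤ n) :
    c * (k ^ 2 - k + 1 - n) * ((n - k - j).choose (k - j) : ℝ) -
        c * (n - 2 * k + 1) *
          (k * (if j + 1 ≤ k then ((n - k - j).choose (k - (j + 1)) : ℝ) else 0) -
          j * (n + 1 - (k + j)).choose (k - j)) =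
      c * eigenvalueProfile n k j := by
  obtain ⟨q, rfl⟩ := Nat.exists_eq_add_of_le hj
  obtain ⟨p, rfl⟩ := Nat.exists_eq_add_of_le hn
  have e1 : 2 * (j + q) + p - (j + q) - j = q + p := by omega
  have e2 : 2 * (j + q) + p + 1 - (j + q + j) = q + p + 1 := by omega
  rw [eigenvalueProfile, disjointEigenvalue, e1, e2, Nat.add_sub_cancel_left]
  rcases q with _ | q
  · simp
    ring
  · have e3 : j + (q + 1) - (j + 1) = q := by omega
    have h1 := congrArg (Nat.cast : ℕ → ℝ) (Nat.choose_succ_right_eq (q + 1 + p) q)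
    have h2 := congrArg (Nat.cast : ℕ → ℝ) (Nat.choose_succ_succ' (q + 1 + p) q)
    have e4 : q + 1 + p - q = p + 1 := by omega
    rw [e4] at h1
    rw [e3, if_pos (by omega), h2]
    push_cast at h1 ⊢
    linear_combination c * ((q : ℝ) + 1) * h1

/-- The eigenvalue belonging to `0`, that is, the row sum of `extremalMatrix`. -/
theorem choose_sub_eigenvalueProfile_zero {n k : ℕ} (hn : 2 * k ≤ n) (hk : 2 ≤ k) :
    (n.choose k : ℝ) + scale n k * eigenvalueProfile n k 0 = (n - 2).choose (k - 2) := by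
  have hM := scale_mul_eigenvalueProfile_two hn hk
  have hP0 := disjointEigenvalue_succ (j := 0) (by omega) hn
  have hP1 := disjointEigenvalue_succ (j := 1) (by omega) hn
  have hn1 : (2 : ℝ) * k ≤ n := by exact_mod_cast hn
  have hk1 : (2 : ℝ) ≤ k := by exact_mod_cast hk
  have hC : (n.choose k : ℝ) * (k * (k - 1)) = n * (n - 1) * (n - 2).choose (k - 2) := by
    obtain ⟨m, rfl⟩ := Nat.exists_eq_add_of_le' (show 2 ≤ n by omega)
    obtain ⟨l, rfl⟩ := Nat.exists_eq_add_of_le' hk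
    have h1 := congrArg (Nat.cast : ℕ → ℝ) (Nat.add_one_mul_choose_eq (m + 1) (l + 1))
    have h2 := congrArg (Nat.cast : ℕ → ℝ) (Nat.add_one_mul_choose_eq m l)
    simp only [Nat.add_sub_cancel]
    push_cast at h1 h2 ⊢
    linear_combination -(l + 1 : ℝ) * h1 - (m + 2 : ℝ) * h2
  simp only [eigenvalueProfile, zero_add, Nat.reduceAdd, Nat.cast_zero, Nat.cast_one,
    Nat.cast_ofNat] at *
  have hkk : ((k : ℝ) * (k - 1)) ≠ 0 := by
    apply ne_of_gt; apply mul_pos <;> linarith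
  apply mul_right_cancel₀ hkk
  generalize disjointEigenvalue n k 0 = P0 at *
  generalize disjointEigenvalue n k 1 = P1 at *
  generalize disjointEigenvalue n k 2 = P2 at *
  generalize scale n k = c at *
  linear_combination hC + c * (n + k - 1) * (k - 1) * hP0 + c * (n + k - 1) * (n - k) * hP1 -
    (n + k - 1) * (n - k) * hM

theorem eigenvalueProfile_one {n k : ℕ} (hn : 2 * k ≤ n) (hk : 2 ≤ k) :
    eigenvalueProfile n k 1 = -eigenvalueProfile n k 2 := by
  have hP1 := disjointEigenvalue_succ (j := 1) (by omega) hn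
  simp only [eigenvalueProfile, Nat.reduceAdd, Nat.cast_one, Nat.cast_ofNat] at *
  linear_combination hP1

theorem eigenvalueProfile_nonneg {n k j : ℕ} (hn : 2 * k ≤ n) (hj2 : 2 ≤ j) (hj : j ≤ k) :
    0 ≤ eigenvalueProfile n k j := by
  refine mul_nonneg (disjointEigenvalue_nonneg n k j) ?_
  have h1 : (2 : ℝ) * k ≤ n := by exact_mod_cast hn
  have h2 : (2 : ℝ) ≤ j := by exact_mod_cast hj2
  have h3 : (j : ℝ) ≤ k := by exact_mod_cast hj
  nlinarith

/-- From `j = 3` on, the binomial coefficient at least halves and the other factor at most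
doubles. -/
theorem eigenvalueProfile_succ_le {n k j : ℕ} (hn : 3 * k ≤ n + 3) (hn2 : 2 * k ≤ n)
    (hj3 : 3 ≤ j) (hj : j < k) :
    eigenvalueProfile n k (j + 1) ≤ eigenvalueProfile n k j := by
  have hP := disjointEigenvalue_succ hj hn2
  have h1 : (3 : ℝ) * k ≤ n + 3 := by exact_mod_cast hn
  have h2 : (3 : ℝ) ≤ j := by exact_mod_cast hj3
  have h3 : (j : ℝ) + 1 ≤ k := by exact_mod_cast hj
  have h4 := disjointEigenvalue_nonneg n k j
  have hpos : (0 : ℝ) < n - k - j := by linarith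
  have hhalf : 2 * disjointEigenvalue n k (j + 1) ≤ disjointEigenvalue n k j := by
    refine le_of_mul_le_mul_right ?_ hpos
    nlinarith
  have hdouble : (j : ℝ) * (n - (j + 1)) - (k - 1) ≤ 2 * ((j - 1) * (n - j) - (k - 1)) := by
    nlinarith
  have hnn : (0 : ℝ) ≤ (j - 1) * (n - j) - (k - 1) := by nlinarith
  simp only [eigenvalueProfile]
  push_cast
  have h5 := disjointEigenvalue_nonneg n k (j + 1)
  calc disjointEigenvalue n k (j + 1) * (((j : ℝ) + 1 - 1) * (n - (j + 1)) - (k - 1))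
      ≤ disjointEigenvalue n k (j + 1) * (2 * ((j - 1) * (n - j) - (k - 1))) := by
        refine mul_le_mul_of_nonneg_left ?_ h5
        linarith
    _ = 2 * disjointEigenvalue n k (j + 1) * ((j - 1) * (n - j) - (k - 1)) := by ring
    _ ≤ _ := mul_le_mul_of_nonneg_right hhalf hnn

/-- The hypothesis `3 * k ≤ n + 3` is sharp here: there is equality for `n = 3 * k - 3`. -/
theorem eigenvalueProfile_four_le {n k : ℕ} (hn : 3 * k ≤ n + 3) (hk : 4 ≤ k) :
    eigenvalueProfile n k 4 ≤ eigenvalueProfile n k 2 := by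
  have hP2 := disjointEigenvalue_succ (n := n) (k := k) (j := 2) (by omega) (by omega)
  have hP3 := disjointEigenvalue_succ (n := n) (k := k) (j := 3) (by omega) (by omega)
  have hP4 := disjointEigenvalue_nonneg n k 4
  obtain ⟨s, rfl⟩ := Nat.exists_eq_add_of_le hk
  obtain ⟨t, ht⟩ := Nat.exists_eq_add_of_le hn
  obtain rfl : n = 9 + 3 * s + t := by omega
  simp only [eigenvalueProfile, Nat.reduceAdd] at *
  generalize disjointEigenvalue _ _ 2 = P2 at *
  generalize disjointEigenvalue _ _ 3 = P3 at *
  generalize disjointEigenvalue _ _ 4 = P4 at *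
  push_cast at *
  have hs : (0 : ℝ) ≤ s := Nat.cast_nonneg s
  have ht : (0 : ℝ) ≤ t := Nat.cast_nonneg t
  have hpos : (0 : ℝ) < (s + 2) * (s + 1) := by positivity
  -- multiplied by `(k - 2) * (k - 3)`, both sides are polynomial multiples of `P4`
  refine le_of_mul_le_mul_right ?_ hpos
  have hpoly : (0 : ℝ) ≤ (2 * s + 4 + t) * (2 * s + 3 + t) * (2 * s + 2 + t) -
      (s + 2) * (s + 1) * (8 * s + 12 + 3 * t) := by
    have : (2 * s + 4 + t) * (2 * s + 3 + t) * (2 * s + 2 + t) -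
      (s + 2) * (s + 1) * (8 * s + 12 + 3 * t) =
        (t : ℝ) * (9 * s ^ 2 + 27 * s + 20 + t * (6 * s + 9) + t ^ 2) := by ring
    rw [this]
    positivity
  have h := mul_nonneg hP4 hpoly
  have e : P2 * ((2 - 1) * (9 + 3 * s + t - 2) - (4 + s - 1)) * ((s + 2) * (s + 1)) =
      P4 * ((2 * s + 4 + t) * (2 * s + 3 + t) * (2 * s + 2 + t)) := by
    linear_combination -(2 * s + 4 + t : ℝ) * (s + 1) * hP2 -
      (2 * s + 4 + t : ℝ) * (2 * s + 3 + t) * hP3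
  rw [e]
  linarith

theorem neg_one_pow_mul_eigenvalueProfile_le {n k j : ℕ} (hk : 3 ≤ k) (hn : 3 * k ≤ n + 3)
    (hj1 : 1 ≤ j) (hj : j ≤ k) :
    (-1) ^ j * eigenvalueProfile n k j ≤ eigenvalueProfile n k 2 := by
  have hn2 : 2 * k ≤ n := by omega
  have h2 := (eigenvalueProfile_two_pos hn2 (by omega)).le
  obtain rfl | rfl | rfl | h4 : j = 1 ∨ j = 2 ∨ j = 3 ∨ 4 ≤ j := by omega
  · rw [eigenvalueProfile_one hn2 (by omega)]; simp
  · simp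
  · have := eigenvalueProfile_nonneg hn2 (show 2 ≤ 3 by omega) hj
    norm_num
    linarith
  · have hle : eigenvalueProfile n k j ≤ eigenvalueProfile n k 2 := by
      induction j, h4 using Nat.le_induction with
      | base => exact eigenvalueProfile_four_le hn hj
      | succ i hi ih =>
        exact (eigenvalueProfile_succ_le hn hn2 (by omega) (by omega)).trans
          (ih (by omega) (by omega))
    have h0 := eigenvalueProfile_nonneg hn2 (by omega : 2 ≤ j) hj
    rcases neg_one_pow_eq_or ℝ j with h | h <;> rw [h] <;> linarith

theorem isLargestEigenvalue_extremalMatrix {n k : ℕ} (hk : 3 ≤ k) (hn : 3 * k ≤ n + 3) :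
    IsLargestEigenvalue (extremalMatrix n k) ((n - 2).choose (k - 2) : ℝ) := by
  have hn2 : 2 * k ≤ n := by omega
  have h0 := choose_sub_eigenvalueProfile_zero hn2 (by omega)
  constructor
  · have hone := intersectionMatrix_mulVec_one n k (scale n k * (k ^ 2 - k + 1 - n))
      (scale n k * (n - 2 * k + 1)) (by omega)
    have he := eigenvalue_eq (scale n k) (Nat.zero_le k) hn2
    rw [if_pos (by omega)] at he
    simp only [Nat.sub_zero, zero_add, Nat.cast_zero, zero_mul, sub_zero] at he
    rw [he, h0] at hone
    obtain ⟨S, -, hS⟩ := exists_subset_card_eq (s := (univ : Finset (Fin n))) (n := k)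
      (by rw [card_univ, Fintype.card_fin]; omega)
    refine Module.End.hasEigenvalue_of_hasEigenvector (x := 1)
      (Module.End.hasEigenvector_iff.2 ⟨Module.End.mem_eigenspace_iff.2 ?_, ?_⟩)
    · rw [Matrix.toLin'_apply]; exact hone
    · exact fun h => one_ne_zero (congrFun h ⟨S, hS⟩)
  · intro μ hμ
    obtain ⟨f, hf⟩ := Module.End.HasEigenvalue.exists_hasEigenvector hμ
    have hfμ := Module.End.mem_eigenspace_iff.1 hf.1
    rw [Matrix.toLin'_apply] at hfμ
    obtain ⟨j, hj, rfl⟩ := exists_eq_of_mulVec_eq_smul hf.2 hfμ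
    rw [eigenvalue_eq _ hj hn2]
    rcases Nat.eq_zero_or_pos j with rfl | hj1
    · rw [if_pos rfl, pow_zero, one_mul, h0]
    · rw [if_neg (by omega), zero_add, ← scale_mul_eigenvalueProfile_two hn2 (by omega),
        mul_left_comm]
      exact mul_le_mul_of_nonneg_left (neg_one_pow_mul_eigenvalueProfile_le hk hn hj1 hj)
        (scale_pos hn2 (by omega)).le

/-! ### Independent sets and admissible matrices -/

/-- If `r` is the largest eigenvalue of a matrix `A` admissible for the Delsarte number, then the
quadratic form of `A` at the indicator vector of an independent set `s` is at least `|s|²` and at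
most `r |s|`. -/
theorem card_le_of_mem_delsarteValues {V : Type*} [Fintype V] [DecidableEq V] {G : SimpleGraph V}
    {r : ℝ} (hr : r ∈ delsarteValues G) {s : Finset V} (hne : s.Nonempty)
    (hs : ∀ i ∈ s, ∀ j ∈ s, ¬ G.Adj i j) :
    (s.card : ℝ) ≤ r := by
  obtain ⟨A, hA, hA1, hAr⟩ := hr
  have hH : (r • (1 : Matrix V V ℝ) - A).IsHermitian := by
    rw [Matrix.IsHermitian, Matrix.conjTranspose_eq_transpose_of_trivial, Matrix.transpose_sub,
      Matrix.transpose_smul, Matrix.transpose_one, hA]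
  have hpsd : (r • (1 : Matrix V V ℝ) - A).PosSemidef := by
    rw [hH.posSemidef_iff_eigenvalues_nonneg]
    intro i
    have hv := hH.mulVec_eigenvectorBasis i
    set v := (hH.eigenvectorBasis i).ofLp with hvdef
    have hv0 : v ≠ 0 := by
      intro h
      have := hH.eigenvectorBasis.orthonormal.ne_zero i
      apply this
      ext l
      exact congrFun h l
    rw [Matrix.sub_mulVec, Matrix.smul_mulVec, Matrix.one_mulVec] at hv
    have hev : Module.End.HasEigenvalue (Matrix.toLin' A) (r - hH.eigenvalues i) := by
      refine Module.End.hasEigenvalue_of_hasEigenvector (x := v)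
        (Module.End.hasEigenvector_iff.2 ⟨Module.End.mem_eigenspace_iff.2 ?_, hv0⟩)
      rw [Matrix.toLin'_apply, sub_smul, ← hv]
      abel
    have := hAr.2 hev
    simp only [Pi.zero_apply]
    linarith
  have h := hpsd.dotProduct_mulVec_nonneg (fun i => if i ∈ s then 1 else 0)
  have hc : (0 : ℝ) < s.card := by exact_mod_cast hne.card_pos
  have hquad : (s.card : ℝ) * s.card ≤ ∑ i ∈ s, ∑ j ∈ s, A i j := by
    calc (s.card : ℝ) * s.card = ∑ i ∈ s, ∑ j ∈ s, (1 : ℝ) := by simp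
      _ ≤ _ := sum_le_sum fun i hi => sum_le_sum fun j hj => hA1 i j (hs i hi j hj)
  rw [Matrix.sub_mulVec, Matrix.smul_mulVec, Matrix.one_mulVec, dotProduct_sub] at h
  have h' : ∑ i ∈ s, ∑ j ∈ s, A i j ≤ s.card * r := by
    simpa [dotProduct, Matrix.mulVec] using h
  have : (s.card : ℝ) * s.card ≤ r * s.card := by linarith
  exact le_of_mul_le_mul_right this hc

theorem generalizedJohnson_adj_iff {n k : ℕ} (hk : 2 ≤ k)
    (A B : {A : Finset (Fin n) // A.card = k}) :
    (generalizedJohnson n k (allBut k 1)).Adj A B ↔ (A.1 ∩ B.1).card = 1 := by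
  have hle : (A.1 ∩ B.1).card ≤ k := (card_le_card inter_subset_left).trans A.2.le
  change A ≠ B ∧ ¬ ((A.1 ∩ B.1).card < k ∧ (A.1 ∩ B.1).card ≠ 1) ↔ _
  constructor
  · rintro ⟨hne, h⟩
    by_contra h1
    refine h ⟨lt_of_le_of_ne hle fun h2 => hne (Subtype.ext ?_), h1⟩
    have hA := eq_of_subset_of_card_le (inter_subset_left (s₁ := A.1) (s₂ := B.1))
      (by rw [h2, A.2])
    have hB := eq_of_subset_of_card_le (inter_subset_right (s₁ := A.1) (s₂ := B.1))
      (by rw [h2, B.2])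
    exact hA.symm.trans hB
  · intro h
    refine ⟨?_, fun h' => h'.2 h⟩
    rintro rfl
    rw [inter_self, A.2] at h
    omega

theorem choose_mem_delsarteValues {n k : ℕ} (hk : 3 ≤ k) (hn : 3 * k ≤ n + 3)
    (hn' : n + k ≤ k ^ 2 + 1) :
    ((n - 2).choose (k - 2) : ℝ) ∈ delsarteValues (generalizedJohnson n k (allBut k 1)) := by
  refine ⟨extremalMatrix n k, intersectionMatrix_isSymm _ _ _ _, ?_,
    isLargestEigenvalue_extremalMatrix hk hn⟩
  intro A B hAB
  rw [generalizedJohnson_adj_iff (by omega)] at hAB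
  have hx : 0 ≤ scale n k * (k ^ 2 - k + 1 - n) := by
    have : (n : ℝ) + k ≤ k ^ 2 + 1 := by exact_mod_cast hn'
    exact mul_nonneg (scale_pos (by omega) (by omega)).le (by linarith)
  simp only [extremalMatrix, intersectionMatrix, Matrix.of_apply, if_neg hAB, sub_zero]
  split_ifs <;> linarith

/-- The `k`-sets containing two fixed points form an independent set. -/
theorem exists_isNIndepSet_generalizedJohnson {n k : ℕ} (hk : 2 ≤ k) (hn : 2 ≤ n) :
    ∃ s, (generalizedJohnson n k (allBut k 1)).IsNIndepSet ((n - 2).choose (k - 2)) s := by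
  obtain ⟨S, -, hS⟩ := exists_subset_card_eq (s := (univ : Finset (Fin n))) (n := 2)
    (by rw [card_univ, Fintype.card_fin]; exact hn)
  refine ⟨({A : {A : Finset (Fin n) // A.card = k} | S ⊆ A.1} : Finset _), ?_, ?_⟩
  · intro A hA B hB _
    rw [generalizedJohnson_adj_iff hk]
    simp only [coe_filter, mem_univ, true_and, Set.mem_ofPred_eq] at hA hB
    have := card_le_card (subset_inter hA hB)
    omega
  · rw [card_filter_superset (by omega), hS]

theorem card_le_of_isIndepSet {n k : ℕ} (hk : 3 ≤ k) (hn : 3 * k ≤ n + 3)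
    (hn' : n + k ≤ k ^ 2 + 1) {t : Finset {A : Finset (Fin n) // A.card = k}}
    (ht : (generalizedJohnson n k (allBut k 1)).IsIndepSet t) :
    t.card ≤ (n - 2).choose (k - 2) := by
  rcases t.eq_empty_or_nonempty with rfl | hne
  · simp
  · exact_mod_cast card_le_of_mem_delsarteValues (choose_mem_delsarteValues hk hn hn') hne
      fun A hA B hB h => ht hA hB h.1 h

theorem card_le_of_isSystem {n k : ℕ} (hk : 3 ≤ k) (hn : 3 * k ≤ n + 3)
    (hn' : n + k ≤ k ^ 2 + 1) {F : Finset (Finset (Fin n))} (hF : IsSystem n k (allBut k 1) F) :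
    F.card ≤ (n - 2).choose (k - 2) := by
  have hcard : (F.subtype fun A => A.card = k).card = F.card := by
    rw [card_subtype, filter_true_of_mem hF.1]
  rw [← hcard]
  refine card_le_of_isIndepSet hk hn hn' fun A hA B hB hne h => h.2 ?_
  rw [mem_coe, mem_subtype] at hA hB
  exact hF.2 _ hA _ hB fun h => hne (Subtype.ext h)

theorem indepNum_generalizedJohnson {n k : ℕ} (hk : 3 ≤ k) (hn : 3 * k ≤ n + 3)
    (hn' : n + k ≤ k ^ 2 + 1) :
    (generalizedJohnson n k (allBut k 1)).indepNum = (n - 2).choose (k - 2) := by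
  obtain ⟨s, hs⟩ := exists_isNIndepSet_generalizedJohnson (n := n) (k := k) (by omega) (by omega)
  obtain ⟨t, ht⟩ := (generalizedJohnson n k (allBut k 1)).exists_isNIndepSet_indepNum
  apply le_antisymm
  · rw [← ht.card_eq]; exact card_le_of_isIndepSet hk hn hn' ht.isIndepSet
  · rw [← hs.card_eq]; exact hs.isIndepSet.card_le_indepNum

theorem isLeast_delsarteValues {n k : ℕ} (hk : 3 ≤ k) (hn : 3 * k ≤ n + 3)
    (hn' : n + k ≤ k ^ 2 + 1) :
    IsLeast (delsarteValues (generalizedJohnson n k (allBut k 1)))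
      ((n - 2).choose (k - 2) : ℝ) := by
  refine ⟨choose_mem_delsarteValues hk hn hn', fun r hr => ?_⟩
  obtain ⟨s, hs⟩ := exists_isNIndepSet_generalizedJohnson (n := n) (k := k) (by omega) (by omega)
  have hne : s.Nonempty := by
    rw [← card_pos, hs.card_eq]
    exact Nat.choose_pos (by omega)
  rw [← hs.card_eq]
  exact card_le_of_mem_delsarteValues hr hne fun A hA B hB h => hs.isIndepSet hA hB h.1 h

end ForbiddenIntersection

theorem mainTheorem1 (n k : ℕ) (hk : 3 ≤ k) (hn : 3 * k ≤ n + 3) (hn' : n + k ≤ k ^ 2 + 1) :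
    (∀ F : Finset (Finset (Fin n)),
      ForbiddenIntersection.IsSystem n k (ForbiddenIntersection.allBut k 1) F →
        F.card ≤ (n - 2).choose (k - 2)) ∧
    (ForbiddenIntersection.generalizedJohnson n k
        (ForbiddenIntersection.allBut k 1)).indepNum = (n - 2).choose (k - 2) ∧
    ForbiddenIntersection.delsarteNumber
        (ForbiddenIntersection.generalizedJohnson n k (ForbiddenIntersection.allBut k 1)) =
      ((n - 2).choose (k - 2) : ℝ) ∧
    IsLeast
      (ForbiddenIntersection.delsarteValues
        (ForbiddenIntersection.generalizedJohnson n k (ForbiddenIntersection.allBut k 1)))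
      (ForbiddenIntersection.delsarteNumber
        (ForbiddenIntersection.generalizedJohnson n k (ForbiddenIntersection.allBut k 1))) := by
  have hleast := ForbiddenIntersection.isLeast_delsarteValues hk hn hn'
  have hnum : ForbiddenIntersection.delsarteNumber
      (ForbiddenIntersection.generalizedJohnson n k (ForbiddenIntersection.allBut k 1)) =
      ((n - 2).choose (k - 2) : ℝ) := hleast.csInf_eq
  exact ⟨fun F hF => ForbiddenIntersection.card_le_of_isSystem hk hn hn' hF,
    ForbiddenIntersection.indepNum_generalizedJohnson hk hn hn', hnum, hnum ▸ hleast⟩
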